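/- Let $O_3=\{0,\tfrac12,1\}$ and let $\neg,\land,\lor,\to$ be the operations on $O_3$ given as follows. Negation: $\neg 0=1$, $\neg\tfrac12=\tfrac12$, $\neg1=0$. Conjunction: $\tfrac12\land\tfrac12=\tfrac12$; $x\land y=0$ if $x=0$ or $y=0$; $x\land y=1$ in the remaining cases. Disjunction: $x\lor y=\neg(\neg x\land\neg y)$. Implication: $0\to y=\tfrac12$, and $x\to y=y$ for $x\in\{\tfrac12,1\}$. Let $\Sigma$ be a propositional signature (connectives of arbitrary finite arities), and let formulas be built from $\Sigma$ and countably infinitely many variables. An *OL-matrix* over $\Sigma$ is a $\Sigma$-algebra $\mathbf A$ on $O_3$ in which the connectives in $\Sigma\cap\{\neg,\lor,\land,\to\}$ are interpreted as above, with designated set $D=\{\tfrac12,1\}$. Write $\Phi\vdash_{\mathbb M}\psi$ if no homomorphism $v$ from formulas to $\mathbf A$ has $v[\Phi]\subseteq D$ and $v(\psi)\notin D$. A single-conclusion Hilbert calculus (a set of rules, closed under substitution instances when applied) *axiomatizes* $\vdash_{\mathbb M}$ if its derivability relation equals $\vdash_{\mathbb M}$. *The multiple-conclusion calculus $\mathsf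 R_\Sigma$.* For $\neg\in\Sigma$ let $\mathsf R_\Sigma=\bigcup_{c\in\Sigma}\mathsf R_c$, where $\Phi/\Psi$ denotes the rule with premises $\Phi$ and alternative conclusions $\Psi$, and (with $t$ the compound formula $p\lor q$, $p\land q$, $p\to q$, respectively): - $\mathsf R_\neg$: $\ p/\neg\neg p;\ \ \neg\neg p/p;\ \ \varnothing/p,\neg p$. - $\mathsf R_\to$: $\ p,t/q;\ \ q/t;\ \ \varnothing/p,t;\ \ p,\neg t/\neg q;\ \ \neg q/\neg t;\ \ \varnothing/p,\neg t$. - $\mathsf R_\lor$: $\ \varnothing/\neg p,t;\ \ \varnothing/\neg q,t;\ \ \neg t/\neg p;\ \ \neg t/\neg q;\ \ \neg t,t/p;\ \ \neg t,t/q;\ \ \neg p,\neg q/\neg t;\ \ \neg p,t/q;\ \ \neg q,t/p;\ \ t/p,q;\ \ p,q/t$. - $\mathsf R_\land$: $\ t/p;\ \ t/q;\ \ p,q/t;\ \ t,\neg t/\neg p;\ \ t,\neg t/\neg q;\ \ \neg p,\neg q/\neg t;\ \ p/t,\neg q;\ \ q/t,\neg p$. - For any other $k$-ary $c\in\Sigma$,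 $\mathsf R_c$ is the set of rules generated from the table of $c$: for all $x_1,\dots,x_k,y\in O_3$ with $y\ne c_{\mathbf A}(x_1,\dots,x_k)$, the rule $$\frac{\Omega_{x_1}(p_1),\dots,\Omega_{x_k}(p_k),\ \Omega_y(c(p_1,\dots,p_k))}{\mho_{x_1}(p_1),\dots,\mho_{x_k}(p_k),\ \mho_y(c(p_1,\dots,p_k))}$$ where $\Omega_x(\varphi)$ consists of $\varphi$ if $x\in D$ and of $\neg\varphi$ if $\neg x\in D$, and $\mho_x(\varphi)=\{\varphi,\neg\varphi\}\setminus\Omega_x(\varphi)$; or $\mathsf R_c$ is any simplification of this set, i.e. any set of finite rules over $\Sigma$ which together with $\mathsf R_\neg$ has the same multiple-conclusion derivability relation as this set together with $\mathsf R_\neg$. *Translation.* For a binary derived connective $\oplus$, $\mathsf R^\oplus$ is the single-conclusion calculus consisting of the rules $$\frac{p\oplus p}{p},\quad \frac{p}{p\oplus q},\quad \frac{p\oplus q}{q\oplus p},\quad \frac{p\oplus(q\oplus r)}{(p\oplus q)\oplus r}$$ and, for each rule $\Phi/\Psi$ of $\mathsf R$ and a variable $p_0$ not occurring in it: $\varnothing/\bigoplus\Psi$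 if $\Phi=\varnothing\neq\Psi$; $\ \{\varphi\oplus p_0:\varphi\in\Phi\}/p_0$ if $\Psi=\varnothing$; and $\{\varphi\oplus p_0:\varphi\in\Phi\}/(\bigoplus\Psi)\oplus p_0$ otherwise. Here $\bigoplus\{\psi_1,\dots,\psi_n\}=\psi_1\oplus(\psi_2\oplus(\cdots\oplus\psi_n))$. **Theorem.** Let $\{\neg,\lor\}\subseteq\Sigma$ or $\{\neg,\land\}\subseteq\Sigma$, and let $\mathbb M$ be an OL-matrix over $\Sigma$. Put $\varphi\Rightarrow\psi:=\neg\varphi\lor\psi$ (where, if $\{\neg,\land\}\subseteq\Sigma$, one may take $\alpha\lor\beta$ to be the formula $\neg(\neg\alpha\land\neg\beta)$) and $\varphi\curlyvee\psi:=(\varphi\Rightarrow\psi)\Rightarrow((\psi\Rightarrow\varphi)\Rightarrow\varphi)$. Then: 1. $\curlyvee$ is a disjunction in $\vdash_{\mathbb M}$: for all $\Gamma,\varphi,\psi,\gamma$, $\ \Gamma,\varphi\curlyvee\psi\vdash_{\mathbb M}\gamma$ iff $\Gamma,\varphi\vdash_{\mathbb M}\gamma$ and $\Gamma,\psi\vdash_{\mathbb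 M}\gamma$. 2. $\vdash_{\mathbb M}$ is axiomatized by $\mathsf R_\Sigma^{\curlyvee}$, for every choice of the auxiliary variables $p_0$. 3. In particular, if $\Sigma\subseteq\{\neg,\lor,\land,\to\}$ (for instance $\{\neg,\land\}$, $\{\neg,\lor\}$ or $\{\neg,\land,\lor\}$), then $\vdash_{\mathbb M}$ is axiomatized by the four rules above for $\oplus=\curlyvee$ together with the following rules for those connectives that are in $\Sigma$ (with $t$ as above): - $\neg$: $\ p\curlyvee r/\neg\neg p\curlyvee r;\ \ \neg\neg p\curlyvee r/p\curlyvee r;\ \ \varnothing/p\curlyvee\neg p$. - $\to$: $\ p\curlyvee r,t\curlyvee r/q\curlyvee r;\ \ q\curlyvee r/t\curlyvee r;\ \ \varnothing/p\curlyvee t;\ \ p\curlyvee r,\neg t\curlyvee r/\neg q\curlyvee r;\ \ \neg q\curlyvee r/\neg t\curlyvee r;\ \ \varnothing/p\curlyvee\neg t$. - $\lor$: $\ \varnothing/\neg p\curlyvee t;\ \ \varnothing/\neg q\curlyvee t;\ \ \neg t\curlyvee r/\neg p\curlyvee r;\ \ \neg t\curlyvee r/\neg q\curlyvee r;\ \ \neg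 t\curlyvee r,t\curlyvee r/p\curlyvee r;\ \ \neg t\curlyvee r,t\curlyvee r/q\curlyvee r;\ \ \neg p\curlyvee r,\neg q\curlyvee r/\neg t\curlyvee r;\ \ \neg p\curlyvee r,t\curlyvee r/q\curlyvee r;\ \ \neg q\curlyvee r,t\curlyvee r/p\curlyvee r;\ \ t\curlyvee r/(p\curlyvee q)\curlyvee r;\ \ p\curlyvee r,q\curlyvee r/t\curlyvee r$. - $\land$: $\ t\curlyvee r/p\curlyvee r;\ \ t\curlyvee r/q\curlyvee r;\ \ p\curlyvee r,q\curlyvee r/t\curlyvee r;\ \ t\curlyvee r,\neg t\curlyvee r/\neg p\curlyvee r;\ \ t\curlyvee r,\neg t\curlyvee r/\neg q\curlyvee r;\ \ \neg p\curlyvee r,\neg q\curlyvee r/\neg t\curlyvee r;\ \ p\curlyvee r/(t\curlyvee\neg q)\curlyvee r;\ \ q\curlyvee r/(t\curlyvee\neg p)\curlyvee r$. -/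

import Mathlib

universe u

namespace Cooper

/-- The three truth values `0`, `1/2`, `1`. -/
inductive V3 where
  | zero
  | half
  | one
  deriving DecidableEq

/-- The connectives of the Logic of Ordinary Discourse: `¬`, `∨`, `∧`, `→`. -/
inductive OLConn where
  | neg
  | or
  | and
  | imp
  deriving DecidableEq

/-- Arities of the connectives of OL. -/
@[reducible]
def OLConn.arity : OLConn → ℕ
  | .neg => 1
  | .or => 2
  | .and => 2
  | .imp => 2

/-- Truth table of `¬`. -/
def negTable : V3 → V3
  | .half => .half
  | .one => .zero
  | .zero => .one

/-- Truth table of `∧`. -/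
def andTable : V3 → V3 → V3
  | .half, .half => .half
  | .half, .one => .one
  | .one, .half => .one
  | .one, .one => .one
  | .zero, _ => .zero
  | .half, .zero => .zero
  | .one, .zero => .zero

/-- Truth table of `∨`. -/
def orTable : V3 → V3 → V3
  | .half, .half => .half
  | .half, .zero => .zero
  | .zero, .half => .zero
  | .zero, .zero => .zero
  | .one, _ => .one
  | .half, .one => .one
  | .zero, .one => .one

/-- Truth table of `→`. -/
def impTable : V3 → V3 → V3
  | .zero, _ => .half
  | .half, y => y
  | .one, y => y

/-- The interpretation of each OL connective. -/
def OLConn.table : (o : OLConn) → (Fin o.arity → V3) → V3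
  | .neg, x => negTable (x ⟨0, by decide⟩)
  | .or, x => orTable (x ⟨0, by decide⟩) (x ⟨1, by decide⟩)
  | .and, x => andTable (x ⟨0, by decide⟩) (x ⟨1, by decide⟩)
  | .imp, x => impTable (x ⟨0, by decide⟩) (x ⟨1, by decide⟩)

/-- A propositional signature `Σ`, split into the set `ol = Σ ∩ {¬, ∨, ∧, →}` and the family
`Extra = Σ \ {¬, ∨, ∧, →}` of remaining connectives, of arbitrary arities. -/
structure Signature where
  ol : Set OLConn
  Extra : Type u
  extraArity : Extra → ℕ

/-- The connectives of a signature. -/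
inductive Signature.Conn (S : Signature.{u}) : Type u where
  | ol (o : OLConn) (h : o ∈ S.ol) : S.Conn
  | extra (e : S.Extra) : S.Conn

/-- The arity of a connective. -/
@[reducible]
def Signature.Conn.arity {S : Signature.{u}} : S.Conn → ℕ
  | .ol o _ => o.arity
  | .extra e => S.extraArity e

/-- Formulas over `S` in the countably many propositional variables `var 0, var 1, …`. -/
inductive Fm (S : Signature.{u}) : Type u where
  | var (n : ℕ) : Fm S
  | app (c : S.Conn) (args : Fin c.arity → Fm S) : Fm S

namespace Fm

variable {S : Signature.{u}}

/-- Application of a substitution. -/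
def subst (σ : ℕ → Fm S) : Fm S → Fm S
  | .var n => σ n
  | .app c a => .app c (fun i => (a i).subst σ)

/-- The variable `n` occurs in the formula. -/
def Occurs (n : ℕ) : Fm S → Prop
  | .var m => m = n
  | .app _ a => ∃ i, (a i).Occurs n

/-- The formula `¬φ`. -/
def neg (h : OLConn.neg ∈ S.ol) (φ : Fm S) : Fm S :=
  .app (.ol .neg h) ![φ]

/-- The formula `φ ∨ ψ`. -/
def or (h : OLConn.or ∈ S.ol) (φ ψ : Fm S) : Fm S :=
  .app (.ol .or h) ![φ, ψ]

/-- The formula `φ ∧ ψ`. -/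
def and (h : OLConn.and ∈ S.ol) (φ ψ : Fm S) : Fm S :=
  .app (.ol .and h) ![φ, ψ]

/-- The formula `φ → ψ`. -/
def imp (h : OLConn.imp ∈ S.ol) (φ ψ : Fm S) : Fm S :=
  .app (.ol .imp h) ![φ, ψ]

end Fm

/-- A three-valued matrix over `S`: an algebra with carrier `V3` and a set of designated values. -/
structure TMatrix (S : Signature.{u}) where
  interp : (c : S.Conn) → (Fin c.arity → V3) → V3
  designated : Set V3

namespace TMatrix

variable {S : Signature.{u}}

/-- An OL-matrix: the OL connectives of the signature have their standard tables, and the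
designated values are `1/2` and `1`. -/
def IsOL (M : TMatrix S) : Prop :=
  (∀ (o : OLConn) (h : o ∈ S.ol), M.interp (.ol o h) = o.table) ∧
    M.designated = {V3.half, V3.one}

/-- Valuations are the homomorphisms from the formula algebra. -/
def IsValuation (M : TMatrix S) (v : Fm S → V3) : Prop :=
  ∀ (c : S.Conn) (a : Fin c.arity → Fm S), v (.app c a) = M.interp c (fun i => v (a i))

/-- The single-conclusion logic `⊢_M`. -/
def Entails (M : TMatrix S) (Φ : Set (Fm S)) (ψ : Fm S) : Prop :=
  ¬ ∃ v : Fm S → V3, M.IsValuation v ∧ (∀ φ ∈ Φ, v φ ∈ M.designated) ∧ v ψ ∉ M.designated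

end TMatrix

/-- `op` is a disjunction in the single-conclusion logic `L`. -/
def IsDisjunction {S : Signature.{u}} (L : Set (Fm S) → Fm S → Prop)
    (op : Fm S → Fm S → Fm S) : Prop :=
  ∀ (Γ : Set (Fm S)) (φ ψ γ : Fm S),
    L (insert (op φ ψ) Γ) γ ↔ L (insert φ Γ) γ ∧ L (insert ψ Γ) γ

/-- A (finitary) multiple-conclusion rule, with its premises and its conclusions listed in the
order in which they are displayed. -/
structure Rule (S : Signature.{u}) where
  prem : List (Fm S)
  concl : List (Fm S)

/-- The variable `n` occurs in the rule. -/
def Rule.Occurs {S : Signature.{u}} (n : ℕ) (r : Rule S) : Prop :=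
  (∃ φ ∈ r.prem, φ.Occurs n) ∨ ∃ φ ∈ r.concl, φ.Occurs n

/-- `Proves R Γ Δ`: there is a proof tree of `(Γ, Δ)` in the Hilbert calculus `R`. Nodes are
labelled by sets of formulas. A leaf is labelled by a set meeting `Δ`; a non-leaf node has one
child for each conclusion of a rule instance whose premises lie in its label (so it is
discontinued if there are no conclusions), labelled by the same set plus that conclusion. -/
inductive Proves {S : Signature.{u}} (R : Set (Rule S)) : Set (Fm S) → Set (Fm S) → Prop where
  | leaf {Γ Δ : Set (Fm S)} (φ : Fm S) (hΓ : φ ∈ Γ) (hΔ : φ ∈ Δ) : Proves R Γ Δ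
  | node {Γ Δ : Set (Fm S)} (r : Rule S) (hr : r ∈ R) (σ : ℕ → Fm S)
      (hprem : ∀ φ ∈ r.prem, φ.subst σ ∈ Γ)
      (hconcl : ∀ ψ ∈ r.concl, Proves R (insert (ψ.subst σ) Γ) Δ) : Proves R Γ Δ

/-- The single-conclusion calculi: all rules have exactly one conclusion. -/
def IsSingleConclusion {S : Signature.{u}} (R : Set (Rule S)) : Prop :=
  ∀ r ∈ R, ∃ φ, r.concl = [φ]

/-- The single-conclusion Hilbert calculus `R` axiomatizes the single-conclusion logic `L`. -/
def AxiomatizesSC {S : Signature.{u}} (R : Set (Rule S)) (L : Set (Fm S) → Fm S → Prop) : Prop :=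
  IsSingleConclusion R ∧ ∀ (Γ : Set (Fm S)) (φ : Fm S), L Γ φ ↔ Proves R Γ {φ}

section MultipleConclusion

variable {S : Signature.{u}}

/-- The multiple-conclusion rules for `¬`. -/
def negRules (hn : OLConn.neg ∈ S.ol) : Set (Rule S) :=
  let p : Fm S := .var 0
  let n := Fm.neg hn
  { ⟨[p], [n (n p)]⟩, ⟨[n (n p)], [p]⟩, ⟨[], [p, n p]⟩ }

/-- The multiple-conclusion rules for `→`. -/
def impRules (hn : OLConn.neg ∈ S.ol) (h : OLConn.imp ∈ S.ol) : Set (Rule S) :=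
  let p : Fm S := .var 0
  let q : Fm S := .var 1
  let n := Fm.neg hn
  let t := Fm.imp h p q
  { ⟨[p, t], [q]⟩, ⟨[q], [t]⟩, ⟨[], [p, t]⟩,
    ⟨[p, n t], [n q]⟩, ⟨[n q], [n t]⟩, ⟨[], [p, n t]⟩ }

/-- The multiple-conclusion rules for `∨`. -/
def orRules (hn : OLConn.neg ∈ S.ol) (h : OLConn.or ∈ S.ol) : Set (Rule S) :=
  let p : Fm S := .var 0
  let q : Fm S := .var 1
  let n := Fm.neg hn
  let t := Fm.or h p q
  { ⟨[], [n p, t]⟩, ⟨[], [n q, t]⟩, ⟨[n t], [n p]⟩, ⟨[n t], [n q]⟩,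
    ⟨[n t, t], [p]⟩, ⟨[n t, t], [q]⟩, ⟨[n p, n q], [n t]⟩,
    ⟨[n p, t], [q]⟩, ⟨[n q, t], [p]⟩, ⟨[t], [p, q]⟩, ⟨[p, q], [t]⟩ }

/-- The multiple-conclusion rules for `∧`. -/
def andRules (hn : OLConn.neg ∈ S.ol) (h : OLConn.and ∈ S.ol) : Set (Rule S) :=
  let p : Fm S := .var 0
  let q : Fm S := .var 1
  let n := Fm.neg hn
  let t := Fm.and h p q
  { ⟨[t], [p]⟩, ⟨[t], [q]⟩, ⟨[p, q], [t]⟩,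
    ⟨[t, n t], [n p]⟩, ⟨[t, n t], [n q]⟩, ⟨[n p, n q], [n t]⟩,
    ⟨[p], [t, n q]⟩, ⟨[q], [t, n p]⟩ }

/-- Those of `φ, ¬φ` that are designated when `φ` has value `x` in an OL-matrix. -/
def sepPos (hn : OLConn.neg ∈ S.ol) (x : V3) (φ : Fm S) : List (Fm S) :=
  match x with
  | .zero => [Fm.neg hn φ]
  | .half => [φ, Fm.neg hn φ]
  | .one => [φ]

/-- Those of `φ, ¬φ` that are not designated when `φ` has value `x` in an OL-matrix. -/
def sepNeg (hn : OLConn.neg ∈ S.ol) (x : V3) (φ : Fm S) : List (Fm S) :=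
  match x with
  | .zero => [φ]
  | .half => []
  | .one => [Fm.neg hn φ]

/-- The rule, over the separators `p` and `¬p`, which says that `c(p₁, …, pₖ)` does not have
value `y` when `p₁, …, pₖ` have values `x₁, …, xₖ`. -/
def tableRule (hn : OLConn.neg ∈ S.ol) (c : S.Conn) (x : Fin c.arity → V3) (y : V3) : Rule S where
  prem := (List.ofFn fun i => sepPos hn (x i) (.var (i : ℕ))).flatten ++
    sepPos hn y (.app c fun i => .var (i : ℕ))
  concl := (List.ofFn fun i => sepNeg hn (x i) (.var (i : ℕ))).flatten ++
    sepNeg hn y (.app c fun i => .var (i : ℕ))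

/-- The rules generated from the truth table of `c` in `M`: one for each incorrect entry. -/
def tableRules (hn : OLConn.neg ∈ S.ol) (M : TMatrix S) (c : S.Conn) : Set (Rule S) :=
  {r | ∃ (x : Fin c.arity → V3) (y : V3), y ≠ M.interp c x ∧ r = tableRule hn c x y}

/-- `R` is a multiple-conclusion calculus for the connective `c` of `M`. For an OL connective it is
the displayed set of rules. For another connective it is the set of rules generated from its truth
table, or any simplification of it: a set of rules that, together with the rules for `¬`,
determines the same multiple-conclusion logic. -/
def IsCalculusFor (hn : OLConn.neg ∈ S.ol) (M : TMatrix S) (c : S.Conn)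
    (R : Set (Rule S)) : Prop :=
  match c with
  | .ol .neg _ => R = negRules hn
  | .ol .or h => R = orRules hn h
  | .ol .and h => R = andRules hn h
  | .ol .imp h => R = impRules hn h
  | .extra e => ∀ Γ Δ : Set (Fm S), Proves (negRules hn ∪ R) Γ Δ ↔
      Proves (negRules hn ∪ tableRules hn M (.extra e)) Γ Δ

end MultipleConclusion

section SingleConclusion

variable {S : Signature.{u}}

/-- `⨁ {φ₁, …, φₘ} = φ₁ ⊕ (φ₂ ⊕ (… ⊕ φₘ))`, for the nonempty list `φ₁ :: [φ₂, …, φₘ]`. -/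
def bigOp (op : Fm S → Fm S → Fm S) : Fm S → List (Fm S) → Fm S
  | φ, [] => φ
  | φ, ψ :: l => op φ (bigOp op ψ l)

/-- The translation `r^⊕` of a rule into a single-conclusion rule, with auxiliary variable `p₀`. -/
def Rule.trans (op : Fm S → Fm S → Fm S) (p₀ : ℕ) : Rule S → Rule S
  | ⟨Φ, []⟩ => ⟨Φ.map fun φ => op φ (.var p₀), [.var p₀]⟩
  | ⟨[], ψ :: Ψ⟩ => ⟨[], [bigOp op ψ Ψ]⟩
  | ⟨φ :: Φ, ψ :: Ψ⟩ =>
      ⟨(φ :: Φ).map fun φ => op φ (.var p₀), [op (bigOp op ψ Ψ) (.var p₀)]⟩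

/-- The four rules of idempotency, weakening, commutativity and associativity of `⊕`. -/
def disjRules (op : Fm S → Fm S → Fm S) : Set (Rule S) :=
  let p : Fm S := .var 0
  let q : Fm S := .var 1
  let r : Fm S := .var 2
  { ⟨[op p p], [p]⟩, ⟨[p], [op p q]⟩, ⟨[op p q], [op q p]⟩,
    ⟨[op p (op q r)], [op (op p q) r]⟩ }

/-- The single-conclusion calculus `R^⊕`, where `p₀ r` is the auxiliary variable chosen for the
rule `r`. -/
def translate (op : Fm S → Fm S → Fm S) (p₀ : Rule S → ℕ) (R : Set (Rule S)) : Set (Rule S) :=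
  disjRules op ∪ {s | ∃ r ∈ R, s = r.trans op (p₀ r)}

/-- `φ ⇒ ψ := ¬φ ∨ ψ`. -/
def arrowOr (hn : OLConn.neg ∈ S.ol) (h : OLConn.or ∈ S.ol) (φ ψ : Fm S) : Fm S :=
  Fm.or h (Fm.neg hn φ) ψ

/-- `φ ⇒ ψ := ¬φ ∨ ψ`, with `α ∨ β := ¬(¬α ∧ ¬β)`. -/
def arrowAnd (hn : OLConn.neg ∈ S.ol) (h : OLConn.and ∈ S.ol) (φ ψ : Fm S) : Fm S :=
  Fm.neg hn (Fm.and h (Fm.neg hn (Fm.neg hn φ)) (Fm.neg hn ψ))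

/-- `φ ⋎ ψ := (φ ⇒ ψ) ⇒ ((ψ ⇒ φ) ⇒ φ)`. -/
def curlyVee (arrow : Fm S → Fm S → Fm S) (φ ψ : Fm S) : Fm S :=
  arrow (arrow φ ψ) (arrow (arrow ψ φ) φ)

/-- The displayed single-conclusion rules for `¬`. -/
def scNegRules (hn : OLConn.neg ∈ S.ol) (op : Fm S → Fm S → Fm S) : Set (Rule S) :=
  let p : Fm S := .var 0
  let r : Fm S := .var 2
  let n := Fm.neg hn
  { ⟨[op p r], [op (n (n p)) r]⟩, ⟨[op (n (n p)) r], [op p r]⟩, ⟨[], [op p (n p)]⟩ }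

/-- The displayed single-conclusion rules for `→`. -/
def scImpRules (hn : OLConn.neg ∈ S.ol) (h : OLConn.imp ∈ S.ol) (op : Fm S → Fm S → Fm S) :
    Set (Rule S) :=
  let p : Fm S := .var 0
  let q : Fm S := .var 1
  let r : Fm S := .var 2
  let n := Fm.neg hn
  let t := Fm.imp h p q
  { ⟨[op p r, op t r], [op q r]⟩, ⟨[op q r], [op t r]⟩, ⟨[], [op p t]⟩,
    ⟨[op p r, op (n t) r], [op (n q) r]⟩, ⟨[op (n q) r], [op (n t) r]⟩, ⟨[], [op p (n t)]⟩ }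

/-- The displayed single-conclusion rules for `∨`. -/
def scOrRules (hn : OLConn.neg ∈ S.ol) (h : OLConn.or ∈ S.ol) (op : Fm S → Fm S → Fm S) :
    Set (Rule S) :=
  let p : Fm S := .var 0
  let q : Fm S := .var 1
  let r : Fm S := .var 2
  let n := Fm.neg hn
  let t := Fm.or h p q
  { ⟨[], [op (n p) t]⟩, ⟨[], [op (n q) t]⟩,
    ⟨[op (n t) r], [op (n p) r]⟩, ⟨[op (n t) r], [op (n q) r]⟩,
    ⟨[op (n t) r, op t r], [op p r]⟩, ⟨[op (n t) r, op t r], [op q r]⟩,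
    ⟨[op (n p) r, op (n q) r], [op (n t) r]⟩,
    ⟨[op (n p) r, op t r], [op q r]⟩, ⟨[op (n q) r, op t r], [op p r]⟩,
    ⟨[op t r], [op (op p q) r]⟩, ⟨[op p r, op q r], [op t r]⟩ }

/-- The displayed single-conclusion rules for `∧`. -/
def scAndRules (hn : OLConn.neg ∈ S.ol) (h : OLConn.and ∈ S.ol) (op : Fm S → Fm S → Fm S) :
    Set (Rule S) :=
  let p : Fm S := .var 0
  let q : Fm S := .var 1
  let r : Fm S := .var 2
  let n := Fm.neg hn
  let t := Fm.and h p q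
  { ⟨[op t r], [op p r]⟩, ⟨[op t r], [op q r]⟩, ⟨[op p r, op q r], [op t r]⟩,
    ⟨[op t r, op (n t) r], [op (n p) r]⟩, ⟨[op t r, op (n t) r], [op (n q) r]⟩,
    ⟨[op (n p) r, op (n q) r], [op (n t) r]⟩,
    ⟨[op p r], [op (op t (n q)) r]⟩, ⟨[op q r], [op (op t (n p)) r]⟩ }

/-- The displayed single-conclusion calculus for the OL connectives of the signature. -/
def scCalculus (hn : OLConn.neg ∈ S.ol) (op : Fm S → Fm S → Fm S) : Set (Rule S) :=
  disjRules op ∪ scNegRules hn op ∪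
    {s | ∃ h : OLConn.imp ∈ S.ol, s ∈ scImpRules hn h op} ∪
    {s | ∃ h : OLConn.or ∈ S.ol, s ∈ scOrRules hn h op} ∪
    {s | ∃ h : OLConn.and ∈ S.ol, s ∈ scAndRules hn h op}

end SingleConclusion

end Cooper

/-! The proof identifies theories of valuations with sets closed under the multiple-conclusion
rules, then transfers this to the single-conclusion calculus. The formulas `φ` and `¬φ` separate the
three values: for value 0 only `¬φ` is designated, for 1/2 both are, for 1 only `φ` is. A set `T`
closed under the multiple-conclusion rules therefore determines a value for every formula
(`valueIn`), the rules force these values to obey the tables (`isValuation_valueIn`), and `T` is the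
theory of that valuation. Conversely every theory of a valuation is closed. The connective `⋎` is
designated exactly if one of its arguments is; this gives the disjunction property and the soundness
of the translated rules. For completeness, let `φ` be underivable from `Γ` in the translated
calculus and take `T ⊇ Γ` maximal not deriving `φ`. Every translated rule can still be applied under
a further disjunct `χ` (`Closed.translate_lift`), so if `T, a` derives `φ` and `a ⋎ b ∈ T`, then `φ
⋎ b ∈ T`. Using this twice and idempotency, `T` is prime. A prime set closed under the translated
rules is closed under the original ones, so it is the theory of a valuation refuting `φ`. -/

namespace Cooper

/-! ### Substitution -/

namespace Fm

variable {S : Signature.{u}}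

theorem subst_neg (hn : OLConn.neg ∈ S.ol) (σ : ℕ → Fm S) (φ : Fm S) :
    (Fm.neg hn φ).subst σ = Fm.neg hn (φ.subst σ) := by
  simp only [Fm.neg, Fm.subst]
  congr 1
  funext i
  fin_cases i
  rfl

theorem subst_or (h : OLConn.or ∈ S.ol) (σ : ℕ → Fm S) (φ ψ : Fm S) :
    (Fm.or h φ ψ).subst σ = Fm.or h (φ.subst σ) (ψ.subst σ) := by
  simp only [Fm.or, Fm.subst]
  congr 1
  funext i
  fin_cases i <;> rfl

theorem subst_and (h : OLConn.and ∈ S.ol) (σ : ℕ → Fm S) (φ ψ : Fm S) :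
    (Fm.and h φ ψ).subst σ = Fm.and h (φ.subst σ) (ψ.subst σ) := by
  simp only [Fm.and, Fm.subst]
  congr 1
  funext i
  fin_cases i <;> rfl

theorem subst_imp (h : OLConn.imp ∈ S.ol) (σ : ℕ → Fm S) (φ ψ : Fm S) :
    (Fm.imp h φ ψ).subst σ = Fm.imp h (φ.subst σ) (ψ.subst σ) := by
  simp only [Fm.imp, Fm.subst]
  congr 1
  funext i
  fin_cases i <;> rfl

theorem subst_update_of_not_occurs (σ : ℕ → Fm S) (n : ℕ) (χ : Fm S) (φ : Fm S)
    (h : ¬ φ.Occurs n) : φ.subst (Function.update σ n χ) = φ.subst σ := by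
  induction φ with
  | var m =>
    simp only [Fm.Occurs] at h
    simp [Fm.subst, Function.update_of_ne h]
  | app c a ih =>
    simp only [Fm.Occurs, not_exists] at h
    simp only [Fm.subst]
    congr 1
    funext i
    exact ih i (h i)

end Fm

/-- `op` commutes with substitutions, as every derived connective does. -/
def Structural {S : Signature.{u}} (op : Fm S → Fm S → Fm S) : Prop :=
  ∀ (σ : ℕ → Fm S) (φ ψ : Fm S), (op φ ψ).subst σ = op (φ.subst σ) (ψ.subst σ)

/-- `T` is closed under the multiple-conclusion rules `R`. -/
def Closed {S : Signature.{u}} (R : Set (Rule S)) (T : Set (Fm S)) : Prop :=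
  ∀ r ∈ R, ∀ σ : ℕ → Fm S, (∀ φ ∈ r.prem, φ.subst σ ∈ T) → ∃ ψ ∈ r.concl, ψ.subst σ ∈ T

/-! ### Closed sets, derivability and maximal sets -/

section Calculi

variable {S : Signature.{u}} {R R' : Set (Rule S)} {T : Set (Fm S)}

theorem Closed.mono (h : Closed R T) (hR : R' ⊆ R) : Closed R' T :=
  fun r hr => h r (hR hr)

theorem Closed.union (h : Closed R T) (h' : Closed R' T) : Closed (R ∪ R') T :=
  fun r hr => hr.elim (h r) (h' r)

/-- Soundness: following at each node a conclusion that lies in `T` leads down the proof tree to a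
leaf meeting `Δ`. -/
theorem Closed.exists_mem (h : Closed R T) {Γ Δ : Set (Fm S)} (hp : Proves R Γ Δ) (hΓ : Γ ⊆ T) :
    ∃ φ ∈ Δ, φ ∈ T := by
  induction hp with
  | leaf φ h1 h2 => exact ⟨φ, h2, hΓ h1⟩
  | node r hr σ hprem _ ih =>
    obtain ⟨ψ, hψ, hT⟩ := h r hr σ fun φ hφ => hΓ (hprem φ hφ)
    exact ih ψ hψ (Set.insert_subset hT hΓ)

/-- Closure thus depends only on the derivability relation, so it is unaffected by replacing a
calculus with an equivalent one. -/
theorem closed_iff_not_proves_compl : Closed R T ↔ ¬ Proves R T Tᶜ := by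
  constructor
  · intro h hp
    obtain ⟨φ, h1, h2⟩ := h.exists_mem hp subset_rfl
    exact h1 h2
  · intro h r hr σ hprem
    by_contra! hc
    exact h (.node r hr σ hprem fun ψ hψ => .leaf _ (Set.mem_insert _ _) (hc ψ hψ))

theorem Proves.mono {Γ Γ' Δ : Set (Fm S)} (h : Proves R Γ Δ) (hΓ : Γ ⊆ Γ') : Proves R Γ' Δ := by
  induction h generalizing Γ' with
  | leaf φ h1 h2 => exact .leaf φ (hΓ h1) h2
  | node r hr σ hprem _ ih =>
    exact .node r hr σ (fun φ hφ => hΓ (hprem φ hφ))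
      fun ψ hψ => ih ψ hψ (Set.insert_subset_insert hΓ)

theorem Proves.exists_finite {Γ Δ : Set (Fm S)} (h : Proves R Γ Δ) :
    ∃ Γ₀ ⊆ Γ, Γ₀.Finite ∧ Proves R Γ₀ Δ := by
  induction h with
  | leaf φ h1 h2 =>
    exact ⟨{φ}, by simpa using h1, Set.finite_singleton _, .leaf φ rfl h2⟩
  | @node Γ Δ r hr σ hprem _ ih =>
    choose! F hF using ih
    set P : Set (Fm S) := {χ | ∃ φ ∈ r.prem, χ = φ.subst σ} with hP
    set Q : Set (Fm S) := ⋃ ψ ∈ {ψ | ψ ∈ r.concl}, F ψ with hQ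
    -- Each `F ψ` may use the new conclusion `ψ.subst σ`, which the rule itself supplies; only its
    -- part inside `Γ` is kept.
    refine ⟨P ∪ (Q ∩ Γ), ?_, ?_, ?_⟩
    · rintro χ (⟨φ, hφ, rfl⟩ | h)
      · exact hprem φ hφ
      · exact h.2
    · refine Set.Finite.union ?_ (Set.Finite.inter_of_left ?_ _)
      · refine ((List.finite_toSet r.prem).image fun φ => φ.subst σ).subset ?_
        rintro χ ⟨φ, hφ, rfl⟩
        exact ⟨φ, hφ, rfl⟩
      · exact (List.finite_toSet r.concl).biUnion fun ψ hψ => (hF ψ hψ).2.1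
    · refine .node r hr σ (fun φ hφ => .inl ⟨φ, hφ, rfl⟩) fun ψ hψ => ?_
      refine (hF ψ hψ).2.2.mono fun χ hχ => ?_
      rcases (hF ψ hψ).1 hχ with rfl | h
      · exact Set.mem_insert _ _
      · exact .inr (.inr ⟨Set.mem_biUnion hψ hχ, h⟩)

/-- Lindenbaum's lemma. -/
theorem exists_maximal_not_proves {Γ Δ : Set (Fm S)} (h : ¬ Proves R Γ Δ) :
    ∃ T, Γ ⊆ T ∧ Maximal (fun T => ¬ Proves R T Δ) T := by
  refine zorn_subset_nonempty {T | ¬ Proves R T Δ} ?_ Γ h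
  intro c hc hchain hne
  refine ⟨⋃₀ c, fun hp => ?_, fun s hs => Set.subset_sUnion_of_mem hs⟩
  obtain ⟨F, hF, hfin, hpF⟩ := hp.exists_finite
  obtain ⟨T, hT, hFT⟩ := hchain.directedOn.exists_mem_subset_of_finite_of_subset_sUnion hne hfin hF
  exact hc hT (hpF.mono hFT)

theorem proves_insert_of_maximal {Δ : Set (Fm S)} (h : Maximal (fun T => ¬ Proves R T Δ) T)
    {φ : Fm S} (hφ : φ ∉ T) : Proves R (insert φ T) Δ := by
  by_contra hc
  exact hφ (h.le_of_ge hc (Set.subset_insert φ T) (Set.mem_insert φ T))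

/-- If no conclusion of an instance were in `T`, maximality would give a proof for each branch, and
the instance would join them into a proof from `T`. -/
theorem closed_of_maximal {Δ : Set (Fm S)} (h : Maximal (fun T => ¬ Proves R T Δ) T) :
    Closed R T := by
  intro r hr σ hprem
  by_contra! hc
  exact h.prop (.node r hr σ hprem fun ψ hψ => proves_insert_of_maximal h (hc ψ hψ))

end Calculi

/-! ### The translated calculus and its prime sets -/

section Disjunction

variable {S : Signature.{u}} {op : Fm S → Fm S → Fm S} {T : Set (Fm S)}

/-- `T` is closed under the rules of idempotency, weakening, commutativity and associativity. -/
structure DisjClosed (op : Fm S → Fm S → Fm S) (T : Set (Fm S)) : Prop where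
  idem {a : Fm S} : op a a ∈ T → a ∈ T
  weak {a : Fm S} (b : Fm S) : a ∈ T → op a b ∈ T
  comm {a b : Fm S} : op a b ∈ T → op b a ∈ T
  assoc {a b c : Fm S} : op a (op b c) ∈ T → op (op a b) c ∈ T

theorem Closed.disjClosed (hop : Structural op) (h : Closed (disjRules op) T) :
    DisjClosed op T where
  idem {a} ha := by
    simpa [hop _, Fm.subst] using h ⟨[op (.var 0) (.var 0)], [.var 0]⟩ (by simp [disjRules])
      (fun _ => a) (by simpa [hop _, Fm.subst] using ha)
  weak {a} b ha := by
    simpa [hop _, Fm.subst] using h ⟨[.var 0], [op (.var 0) (.var 1)]⟩ (by simp [disjRules])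
      (fun | 0 => a | _ => b) (by simpa [hop _, Fm.subst] using ha)
  comm {a b} ha := by
    simpa [hop _, Fm.subst] using h ⟨[op (.var 0) (.var 1)], [op (.var 1) (.var 0)]⟩
      (by simp [disjRules])
      (fun | 0 => a | _ => b) (by simpa [hop _, Fm.subst] using ha)
  assoc {a b c} ha := by
    simpa [hop _, Fm.subst] using h ⟨[op (.var 0) (op (.var 1) (.var 2))],
      [op (op (.var 0) (.var 1)) (.var 2)]⟩ (by simp [disjRules])
      (fun | 0 => a | 1 => b | _ => c) (by simpa [hop _, Fm.subst] using ha)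

namespace DisjClosed

variable {a b c d : Fm S}

/-- Commutativity turns associativity into a cyclic rotation of three disjuncts; iterating it yields
the converse direction. -/
theorem assoc' (h : DisjClosed op T) (ha : op (op a b) c ∈ T) : op a (op b c) ∈ T :=
  h.comm (h.assoc (h.comm (h.assoc (h.comm ha))))

theorem weak_left (h : DisjClosed op T) (ha : op b c ∈ T) : op (op a b) c ∈ T :=
  h.assoc (h.comm (h.weak a ha))

/-- The four rules carry no side formula, so their versions under a disjunct must be derived. The
pattern: weaken until the desired formula occurs twice, regroup it as `x ⊕ x`, and contract at the
top level. -/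
theorem idem_lift (h : DisjClosed op T) (ha : op (op a a) c ∈ T) : op a c ∈ T :=
  h.idem (h.assoc' (h.weak c (h.comm (h.assoc' ha))))

theorem comm_lift (h : DisjClosed op T) (ha : op (op a b) c ∈ T) : op (op b a) c ∈ T := by
  have h1 : op (op c a) b ∈ T := h.assoc (h.comm ha)
  have h2 : op (op c a) (op b a) ∈ T := h.assoc' (h.weak a h1)
  have h3 : op a (op (op b a) c) ∈ T := h.comm (h.assoc (h.comm h2))
  have h4 : op (op b a) (op (op b a) c) ∈ T := h.weak_left h3
  exact h.idem (h.assoc' (h.weak c (h.comm h4)))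

theorem weak_right (h : DisjClosed op T) (ha : op a c ∈ T) : op (op a b) c ∈ T :=
  h.comm_lift (h.weak_left ha)

theorem assoc_lift (h : DisjClosed op T) (ha : op (op a (op b c)) d ∈ T) : op (op (op a b) c) d ∈ T := by
  have h1 : op (op b c) (op a d) ∈ T := h.assoc' (h.comm_lift ha)
  have h2 : op (op a b) (op c (op a d)) ∈ T := h.weak_left (h.assoc' h1)
  have h3 : op c (op (op a d) (op a b)) ∈ T := h.assoc' (h.comm h2)
  have h4 : op (op c d) (op (op a d) (op a b)) ∈ T := h.weak_right h3
  have h5 : op a (op d (op (op a b) (op c d))) ∈ T := h.assoc' (h.assoc' (h.comm h4))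
  have h6 : op d (op (op (op a b) (op c d)) (op a b)) ∈ T := h.assoc' (h.comm (h.weak_right h5))
  -- Here the doubled formula is `(a ⊕ b) ⊕ (c ⊕ d)`.
  exact h.assoc (h.idem (h.assoc' (h.comm (h.weak_left h6))))

end DisjClosed


theorem mem_of_bigOp_mem (hprime : ∀ a b, op a b ∈ T → a ∈ T ∨ b ∈ T) (σ : ℕ → Fm S)
    (hop : Structural op) (l : List (Fm S)) (φ : Fm S) (h : (bigOp op φ l).subst σ ∈ T) :
    ∃ ψ ∈ φ :: l, ψ.subst σ ∈ T := by
  induction l generalizing φ with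
  | nil => exact ⟨φ, by simp, h⟩
  | cons χ l ih =>
    rw [bigOp, hop] at h
    rcases hprime _ _ h with h | h
    · exact ⟨φ, by simp, h⟩
    · obtain ⟨ψ, hψ, h⟩ := ih χ h
      exact ⟨ψ, List.mem_cons_of_mem _ hψ, h⟩

theorem bigOp_mem_of_mem (hiff : ∀ a b, op a b ∈ T ↔ a ∈ T ∨ b ∈ T) (σ : ℕ → Fm S)
    (hop : Structural op) (l : List (Fm S)) (φ : Fm S)
    (h : ∃ ψ ∈ φ :: l, ψ.subst σ ∈ T) : (bigOp op φ l).subst σ ∈ T := by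
  induction l generalizing φ with
  | nil => simpa [bigOp] using h
  | cons χ l ih =>
    rw [bigOp, hop, hiff]
    obtain ⟨ψ, hψ, h⟩ := h
    rcases List.mem_cons.1 hψ with rfl | hψ
    · exact .inl h
    · exact .inr (ih χ ⟨ψ, hψ, h⟩)

theorem subst_bigOp (hop : Structural op) (σ : ℕ → Fm S) (l : List (Fm S)) (φ : Fm S) :
    (bigOp op φ l).subst σ = bigOp op (φ.subst σ) (l.map fun ψ => ψ.subst σ) := by
  induction l generalizing φ with
  | nil => rfl
  | cons χ l ih => rw [bigOp, hop, ih]; rfl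

theorem isSingleConclusion_translate (p₀ : Rule S → ℕ) (R : Set (Rule S)) :
    IsSingleConclusion (translate op p₀ R) := by
  rintro _ (h | ⟨⟨Φ, Ψ⟩, -, rfl⟩)
  · rcases h with rfl | rfl | rfl | rfl <;> exact ⟨_, rfl⟩
  · cases Ψ <;> cases Φ <;> exact ⟨_, rfl⟩

/-- If `⊕` behaves as a disjunction on `T`, then the translated rules hold in `T`. -/
theorem Closed.translate (hop : Structural op) (hiff : ∀ a b, op a b ∈ T ↔ a ∈ T ∨ b ∈ T)
    {R : Set (Rule S)} (h : Closed R T) (p₀ : Rule S → ℕ) : Closed (translate op p₀ R) T := by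
  rintro _ (hr | ⟨r, hr, rfl⟩) σ hprem
  · rcases hr with rfl | rfl | rfl | rfl <;>
      simp only [List.mem_singleton, forall_eq, exists_eq_left, hop _, hiff] at hprem ⊢ <;> tauto
  · have key := h r hr σ
    obtain ⟨Φ, Ψ⟩ := r
    generalize p₀ ⟨Φ, Ψ⟩ = n at hprem ⊢
    -- If the side formula is in `T`, every conclusion containing it as a disjunct holds; otherwise
    -- it can be dropped from all premises and conclusions.
    by_cases hn : σ n ∈ T
    · cases Ψ <;> cases Φ <;>
        simp only [Rule.trans, List.mem_singleton, exists_eq_left, hop _, hiff, Fm.subst, hn,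
          or_true]
      exact bigOp_mem_of_mem hiff σ hop _ _ (key (by simp))
    · have hΦ : (∀ φ ∈ Φ.map fun φ => op φ (.var n), φ.subst σ ∈ T) → ∀ φ ∈ Φ, φ.subst σ ∈ T := by
        intro H φ hφ
        have := H _ (List.mem_map_of_mem hφ)
        simpa [hop _, hiff, Fm.subst, hn] using this
      cases Ψ with
      | nil => simpa using key (hΦ hprem)
      | cons ψ Ψ =>
        cases Φ with
        | nil =>
          exact ⟨_, List.mem_singleton_self _, bigOp_mem_of_mem hiff σ hop _ _ (key (by simp))⟩
        | cons φ Φ =>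
          refine ⟨_, List.mem_singleton_self _, ?_⟩
          rw [hop, hiff]
          exact .inl (bigOp_mem_of_mem hiff σ hop _ _ (key (hΦ hprem)))

/-- A translated rule whose auxiliary variable is fresh holds with any side formula. -/
theorem Closed.trans_apply (hop : Structural op) (hd : DisjClosed op T) {r : Rule S} {n : ℕ}
    (hn : ¬ r.Occurs n) (h : Closed {r.trans op n} T) (σ : ℕ → Fm S) (χ : Fm S)
    (hprem : ∀ φ ∈ r.prem, op (φ.subst σ) χ ∈ T) :
    (r.concl = [] ∧ χ ∈ T) ∨
      ∃ ψ Ψ, r.concl = ψ :: Ψ ∧ op ((bigOp op ψ Ψ).subst σ) χ ∈ T := by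
  obtain ⟨Φ, Ψ⟩ := r
  have hΦ : ∀ φ ∈ Φ, φ.subst (Function.update σ n χ) = φ.subst σ := fun φ hφ =>
    Fm.subst_update_of_not_occurs σ n χ φ fun ho => hn (.inl ⟨φ, hφ, ho⟩)
  have hΨ : ∀ ψ ∈ Ψ, ψ.subst (Function.update σ n χ) = ψ.subst σ := fun ψ hψ =>
    Fm.subst_update_of_not_occurs σ n χ ψ fun ho => hn (.inr ⟨ψ, hψ, ho⟩)
  have hmap : ∀ φ ∈ Φ.map fun φ => op φ (.var n), φ.subst (Function.update σ n χ) ∈ T := by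
    intro φ hφ
    obtain ⟨θ, hθ, rfl⟩ := List.mem_map.1 hφ
    rw [hop, hΦ θ hθ]
    simpa [Fm.subst] using hprem θ hθ
  cases Ψ with
  | nil =>
    obtain ⟨ψ, hψ, hT⟩ := h _ rfl (Function.update σ n χ) hmap
    obtain rfl := List.mem_singleton.1 hψ
    exact .inl ⟨rfl, by simpa [Fm.subst] using hT⟩
  | cons ψ Ψ =>
    refine .inr ⟨ψ, Ψ, rfl, ?_⟩
    have hbig : (bigOp op ψ Ψ).subst (Function.update σ n χ) = (bigOp op ψ Ψ).subst σ := by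
      rw [subst_bigOp hop, subst_bigOp hop, hΨ ψ (by simp),
        List.map_congr_left fun φ hφ => hΨ φ (List.mem_cons_of_mem _ hφ)]
    cases Φ with
    | nil =>
      obtain ⟨φ, hφ, hT⟩ := h _ rfl (Function.update σ n χ) (by simp [Rule.trans])
      obtain rfl := List.mem_singleton.1 hφ
      rw [hbig] at hT
      -- A translated rule without premises carries no auxiliary variable; weakening supplies the
      -- side formula.
      exact hd.weak χ hT
    | cons φ Φ =>
      obtain ⟨θ, hθ, hT⟩ := h _ rfl (Function.update σ n χ) hmap
      obtain rfl := List.mem_singleton.1 hθ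
      rw [hop, hbig] at hT
      simpa [Fm.subst] using hT

/-- The rules of the translated calculus may be applied under a disjunction. -/
theorem Closed.translate_lift (hop : Structural op) {R : Set (Rule S)} {p₀ : Rule S → ℕ}
    (hp₀ : ∀ r ∈ R, ¬ r.Occurs (p₀ r)) (h : Closed (Cooper.translate op p₀ R) T)
    {s : Rule S} (hs : s ∈ Cooper.translate op p₀ R) (σ : ℕ → Fm S) (χ : Fm S)
    (hprem : ∀ φ ∈ s.prem, op (φ.subst σ) χ ∈ T) :
    ∃ ψ ∈ s.concl, op (ψ.subst σ) χ ∈ T := by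
  have hd := (h.mono Set.subset_union_left).disjClosed hop
  rcases hs with hs | ⟨r, hr, rfl⟩
  · rcases hs with rfl | rfl | rfl | rfl <;>
      simp only [List.mem_singleton, forall_eq, exists_eq_left, hop _] at hprem ⊢
    · exact hd.idem_lift hprem
    · exact hd.weak_right hprem
    · exact hd.comm_lift hprem
    · exact hd.assoc_lift hprem
  · have hr' : Closed {r.trans op (p₀ r)} T :=
      h.mono (Set.singleton_subset_iff.2 (.inr ⟨r, hr, rfl⟩))
    -- The auxiliary variable already holds a side formula, so it is reinstantiated by `σ (p₀ r) ⊕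
    -- χ`; freshness keeps the rest of the instance fixed, and associativity moves `χ` in and out.
    have key := hr'.trans_apply hop hd (hp₀ r hr) σ (op (σ (p₀ r)) χ)
    generalize p₀ r = n at *
    obtain ⟨Φ, Ψ⟩ := r
    have hΦ : (∀ φ ∈ Φ.map fun φ => op φ (.var n), op (φ.subst σ) χ ∈ T) →
        ∀ φ ∈ Φ, op (φ.subst σ) (op (σ n) χ) ∈ T := by
      intro H φ hφ
      have := H _ (List.mem_map_of_mem hφ)
      rw [hop] at this
      exact hd.assoc' this
    cases Ψ with
    | nil => simpa [Rule.trans, Fm.subst] using key (hΦ hprem)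
    | cons ψ Ψ =>
      cases Φ with
      | nil =>
        obtain ⟨φ, hφ, hT⟩ := hr' _ rfl σ (by simp [Rule.trans])
        exact ⟨φ, hφ, hd.weak χ hT⟩
      | cons φ Φ =>
        refine ⟨_, List.mem_singleton_self _, ?_⟩
        rw [hop]
        exact hd.assoc (by simpa [Fm.subst] using key (hΦ hprem))

/-- A whole proof can be carried out under the disjunct `χ`, by lifting each node. This is the
syntactic form of proof by cases. -/
theorem op_mem_of_proves (hop : Structural op) {R : Set (Rule S)} {p₀ : Rule S → ℕ}
    (hp₀ : ∀ r ∈ R, ¬ r.Occurs (p₀ r)) (h : Closed (translate op p₀ R) T) (χ : Fm S)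
    {Γ Δ : Set (Fm S)} (hp : Proves (translate op p₀ R) Γ Δ) (hΓ : ∀ γ ∈ Γ, op γ χ ∈ T) :
    ∃ φ ∈ Δ, op φ χ ∈ T := by
  induction hp with
  | leaf φ h1 h2 => exact ⟨φ, h2, hΓ φ h1⟩
  | node r hr σ hprem _ ih =>
    obtain ⟨ψ, hψ, hT⟩ := h.translate_lift hop hp₀ hr σ χ fun φ hφ => hΓ _ (hprem φ hφ)
    exact ih ψ hψ (by simpa using ⟨hT, hΓ⟩)

/-- A formula underivable in the translated calculus is avoided by some set of formulas that is
closed under the original multiple-conclusion calculus. -/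
theorem exists_closed_of_not_proves_translate (hop : Structural op) {R : Set (Rule S)}
    {p₀ : Rule S → ℕ} (hp₀ : ∀ r ∈ R, ¬ r.Occurs (p₀ r)) {Γ : Set (Fm S)} {φ : Fm S}
    (h : ¬ Proves (translate op p₀ R) Γ {φ}) : ∃ T, Γ ⊆ T ∧ φ ∉ T ∧ Closed R T := by
  obtain ⟨T, hΓ, hmax⟩ := exists_maximal_not_proves h
  have hT := closed_of_maximal hmax
  have hd := (hT.mono Set.subset_union_left).disjClosed hop
  have hφ : φ ∉ T := fun hc => hmax.prop (.leaf φ hc rfl)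
  have hprime : ∀ a b, op a b ∈ T → a ∈ T ∨ b ∈ T := by
    intro a b hab
    by_contra! hc
    -- Under the disjunct `b`, the proof from `insert a T` gives `φ ⊕ b ∈ T`; under the disjunct
    -- `φ`, the proof from `insert b T` then gives `φ ⊕ φ ∈ T`.
    obtain ⟨_, rfl, h1⟩ := op_mem_of_proves hop hp₀ hT b (proves_insert_of_maximal hmax hc.1)
      (by simpa using ⟨hab, fun γ hγ => hd.weak b hγ⟩)
    obtain ⟨_, rfl, h2⟩ := op_mem_of_proves hop hp₀ hT _ (proves_insert_of_maximal hmax hc.2)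
      (by simpa using ⟨hd.comm h1, fun γ hγ => hd.weak _ hγ⟩)
    exact hφ (hd.idem h2)
  refine ⟨T, hΓ, hφ, fun r hr σ hprem => ?_⟩
  -- Taking `φ` itself as side formula: since `φ ∉ T`, primality discards it from the conclusion.
  rcases Closed.trans_apply hop hd (hp₀ r hr)
      (hT.mono (Set.singleton_subset_iff.2 (.inr ⟨r, hr, rfl⟩))) σ φ
      (fun ψ hψ => hd.weak φ (hprem ψ hψ)) with ⟨-, hc⟩ | ⟨ψ, Ψ, hΨ, hc⟩
  · exact absurd hc hφ
  · rw [hΨ]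
    exact mem_of_bigOp_mem hprime σ hop Ψ ψ ((hprime _ _ hc).resolve_right hφ)

end Disjunction

/-! ### Theories of valuations as closed sets -/

section Matrix

variable {S : Signature.{u}} {M : TMatrix S} {v : Fm S → V3} {T : Set (Fm S)}

/-- The theory of a valuation: the formulas to which it gives a designated value. -/
def theoryOf (v : Fm S → V3) : Set (Fm S) := {φ | v φ ≠ .zero}

theorem TMatrix.IsOL.mem_designated (hM : M.IsOL) (x : V3) : x ∈ M.designated ↔ x ≠ .zero := by
  rw [hM.2]
  cases x <;> simp

theorem TMatrix.IsOL.entails_iff (hM : M.IsOL) (Φ : Set (Fm S)) (ψ : Fm S) :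
    M.Entails Φ ψ ↔ ∀ v, M.IsValuation v → Φ ⊆ theoryOf v → ψ ∈ theoryOf v := by
  simp only [TMatrix.Entails, hM.mem_designated, theoryOf, not_exists, not_and, not_not]
  rfl

namespace TMatrix.IsValuation

theorem neg (hv : M.IsValuation v) (hM : M.IsOL) (hn : OLConn.neg ∈ S.ol) (φ : Fm S) :
    v (Fm.neg hn φ) = negTable (v φ) := by
  rw [Fm.neg, hv, hM.1]
  rfl

theorem or (hv : M.IsValuation v) (hM : M.IsOL) (h : OLConn.or ∈ S.ol) (φ ψ : Fm S) :
    v (Fm.or h φ ψ) = orTable (v φ) (v ψ) := by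
  rw [Fm.or, hv, hM.1]
  rfl

theorem and (hv : M.IsValuation v) (hM : M.IsOL) (h : OLConn.and ∈ S.ol) (φ ψ : Fm S) :
    v (Fm.and h φ ψ) = andTable (v φ) (v ψ) := by
  rw [Fm.and, hv, hM.1]
  rfl

theorem imp (hv : M.IsValuation v) (hM : M.IsOL) (h : OLConn.imp ∈ S.ol) (φ ψ : Fm S) :
    v (Fm.imp h φ ψ) = impTable (v φ) (v ψ) := by
  rw [Fm.imp, hv, hM.1]
  rfl

theorem closed_negRules (hv : M.IsValuation v) (hM : M.IsOL) (hn : OLConn.neg ∈ S.ol) :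
    Closed (negRules hn) (theoryOf v) := by
  rintro r hr σ hprem
  rcases hr with rfl | rfl | rfl <;>
    simp [theoryOf, Fm.subst, Fm.subst_neg, hv.neg hM] at hprem ⊢ <;>
    cases h : v (σ 0) <;> simp_all [negTable]

theorem closed_orRules (hv : M.IsValuation v) (hM : M.IsOL) (hn : OLConn.neg ∈ S.ol)
    (h : OLConn.or ∈ S.ol) : Closed (orRules hn h) (theoryOf v) := by
  rintro r hr σ hprem
  rcases hr with rfl | rfl | rfl | rfl | rfl | rfl | rfl | rfl | rfl | rfl | rfl <;>
    simp [theoryOf, Fm.subst, Fm.subst_neg, Fm.subst_or, hv.neg hM, hv.or hM] at hprem ⊢ <;>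
    cases h0 : v (σ 0) <;> cases h1 : v (σ 1) <;> simp_all [negTable, orTable]

theorem closed_andRules (hv : M.IsValuation v) (hM : M.IsOL) (hn : OLConn.neg ∈ S.ol)
    (h : OLConn.and ∈ S.ol) : Closed (andRules hn h) (theoryOf v) := by
  rintro r hr σ hprem
  rcases hr with rfl | rfl | rfl | rfl | rfl | rfl | rfl | rfl <;>
    simp [theoryOf, Fm.subst, Fm.subst_neg, Fm.subst_and, hv.neg hM, hv.and hM] at hprem ⊢ <;>
    cases h0 : v (σ 0) <;> cases h1 : v (σ 1) <;> simp_all [negTable, andTable]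

theorem closed_impRules (hv : M.IsValuation v) (hM : M.IsOL) (hn : OLConn.neg ∈ S.ol)
    (h : OLConn.imp ∈ S.ol) : Closed (impRules hn h) (theoryOf v) := by
  rintro r hr σ hprem
  rcases hr with rfl | rfl | rfl | rfl | rfl | rfl <;>
    simp [theoryOf, Fm.subst, Fm.subst_neg, Fm.subst_imp, hv.neg hM, hv.imp hM] at hprem ⊢ <;>
    cases h0 : v (σ 0) <;> cases h1 : v (σ 1) <;> simp_all [negTable, impTable]

end TMatrix.IsValuation

/-- Only the equation for `¬` is required, because this is also applied to `valueIn` before it is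
known to be a homomorphism. -/
theorem eq_iff_separators (hn : OLConn.neg ∈ S.ol)
    (hneg : ∀ φ, v (Fm.neg hn φ) = negTable (v φ)) (x : V3) (φ : Fm S) :
    v φ = x ↔ (∀ ψ ∈ sepPos hn x φ, ψ ∈ theoryOf v) ∧ ∀ ψ ∈ sepNeg hn x φ, ψ ∉ theoryOf v := by
  cases x <;> simp [sepPos, sepNeg, theoryOf, hneg] <;> cases v φ <;> simp [negTable]

theorem map_subst_sepPos (hn : OLConn.neg ∈ S.ol) (x : V3) (φ : Fm S) (σ : ℕ → Fm S) :
    (sepPos hn x φ).map (Fm.subst σ) = sepPos hn x (φ.subst σ) := by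
  cases x <;> simp [sepPos, Fm.subst_neg]

theorem map_subst_sepNeg (hn : OLConn.neg ∈ S.ol) (x : V3) (φ : Fm S) (σ : ℕ → Fm S) :
    (sepNeg hn x φ).map (Fm.subst σ) = sepNeg hn x (φ.subst σ) := by
  cases x <;> simp [sepNeg, Fm.subst_neg]

/-- The rule for the entry `c(x) ≠ y` holds at `σ` exactly if the valuation does not take the
values `x` and `y` there. -/
theorem tableRule_holds_iff (hn : OLConn.neg ∈ S.ol)
    (hneg : ∀ φ, v (Fm.neg hn φ) = negTable (v φ)) (c : S.Conn) (x : Fin c.arity → V3) (y : V3)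
    (σ : ℕ → Fm S) :
    ((∀ φ ∈ (tableRule hn c x y).prem, φ.subst σ ∈ theoryOf v) →
        ∃ ψ ∈ (tableRule hn c x y).concl, ψ.subst σ ∈ theoryOf v) ↔
      ¬ ((∀ i : Fin c.arity, v (σ i) = x i) ∧ v (.app c fun i => σ i) = y) := by
  have hpos : ∀ x φ, (∀ ψ ∈ sepPos hn x φ, ψ.subst σ ∈ theoryOf v) ↔
      ∀ ψ ∈ sepPos hn x (φ.subst σ), ψ ∈ theoryOf v := by
    intro x φ
    rw [← map_subst_sepPos]
    simp
  have hnegt : ∀ x φ, (∀ ψ ∈ sepNeg hn x φ, ψ.subst σ ∉ theoryOf v) ↔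
      ∀ ψ ∈ sepNeg hn x (φ.subst σ), ψ ∉ theoryOf v := by
    intro x φ
    rw [← map_subst_sepNeg]
    simp
  -- The rule fails at `σ` exactly if all positive separators are in the theory and all negative
  -- ones are outside it.
  rw [← not_iff_not, not_not]
  push Not
  simp only [tableRule, List.forall_mem_append, List.forall_mem_flatten, List.forall_mem_ofFn_iff,
    hpos, hnegt, eq_iff_separators hn hneg, Fm.subst, forall_and]
  tauto

theorem TMatrix.IsValuation.closed_tableRules (hv : M.IsValuation v) (hM : M.IsOL)
    (hn : OLConn.neg ∈ S.ol) (c : S.Conn) : Closed (tableRules hn M c) (theoryOf v) := by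
  rintro _ ⟨x, y, hy, rfl⟩ σ
  refine (tableRule_holds_iff hn (hv.neg hM hn) c x y σ).2 fun ⟨hx, hc⟩ => hy ?_
  rw [← hc, hv]
  exact congrArg _ (funext hx)

theorem interp_of_closed_tableRules (hn : OLConn.neg ∈ S.ol)
    (hneg : ∀ φ, v (Fm.neg hn φ) = negTable (v φ)) (c : S.Conn)
    (h : Closed (tableRules hn M c) (theoryOf v)) (a : Fin c.arity → Fm S) :
    v (.app c a) = M.interp c fun i => v (a i) := by
  by_contra hne
  -- The rule excluding the supposed wrong entry fails at the arguments `a`. Its variables have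
  -- index below the arity, so the default value `.var 0` is immaterial.
  have := h _ ⟨_, _, hne, rfl⟩ fun n => if hlt : n < c.arity then a ⟨n, hlt⟩ else .var 0
  rw [tableRule_holds_iff hn hneg] at this
  simp at this

theorem IsCalculusFor.closed_extra (hn : OLConn.neg ∈ S.ol) {e : S.Extra} {R : Set (Rule S)}
    (hR : IsCalculusFor hn M (.extra e) R) (hneg : Closed (negRules hn) T) :
    Closed R T ↔ Closed (tableRules hn M (.extra e)) T := by
  have key : Closed (negRules hn ∪ R) T ↔ Closed (negRules hn ∪ tableRules hn M (.extra e)) T := by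
    rw [closed_iff_not_proves_compl, closed_iff_not_proves_compl, hR T Tᶜ]
  constructor
  · intro h
    exact (key.1 (hneg.union h)).mono Set.subset_union_right
  · intro h
    exact (key.2 (hneg.union h)).mono Set.subset_union_right

theorem TMatrix.IsValuation.closed_of_isCalculusFor (hv : M.IsValuation v) (hM : M.IsOL)
    (hn : OLConn.neg ∈ S.ol) {c : S.Conn} {R : Set (Rule S)} (hR : IsCalculusFor hn M c R) :
    Closed R (theoryOf v) := by
  rcases c with ⟨_ | _ | _ | _, h⟩ | e
  · obtain rfl : R = negRules hn := hR
    exact hv.closed_negRules hM hn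
  · obtain rfl : R = orRules hn h := hR
    exact hv.closed_orRules hM hn h
  · obtain rfl : R = andRules hn h := hR
    exact hv.closed_andRules hM hn h
  · obtain rfl : R = impRules hn h := hR
    exact hv.closed_impRules hM hn h
  · exact (hR.closed_extra hn (hv.closed_negRules hM hn)).2 (hv.closed_tableRules hM hn _)

open Classical in
/-- The truth value of `φ` determined by which of `φ`, `¬φ` belong to `T`. -/
noncomputable def valueIn (hn : OLConn.neg ∈ S.ol) (T : Set (Fm S)) (φ : Fm S) : V3 :=
  if φ ∈ T then if Fm.neg hn φ ∈ T then .half else .one else .zero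

theorem theoryOf_valueIn (hn : OLConn.neg ∈ S.ol) (T : Set (Fm S)) :
    theoryOf (valueIn hn T) = T := by
  ext φ
  simp only [theoryOf, valueIn, Set.mem_ofPred_eq]
  split_ifs <;> simp_all

/-- A rule instance with propositional variables `0` and `1` in a closed set. -/
theorem Closed.apply_two {R : Set (Rule S)} (h : Closed R T) (φ ψ : Fm S) (Φ Ψ : List (Fm S))
    (hr : ⟨Φ, Ψ⟩ ∈ R) :
    (∀ θ ∈ Φ, θ.subst (fun n => if n = 0 then φ else ψ) ∈ T) →
      ∃ θ ∈ Ψ, θ.subst (fun n => if n = 0 then φ else ψ) ∈ T :=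
  h _ hr _

/-- Each entry of the table is forced by instances of the rules, checked by cases on which of the
formulas involved lie in `T`. The other three connectives are handled alike. -/
theorem valueIn_neg (hn : OLConn.neg ∈ S.ol) (h : Closed (negRules hn) T) (φ : Fm S) :
    valueIn hn T (Fm.neg hn φ) = negTable (valueIn hn T φ) := by
  have H := fun Φ Ψ => h.apply_two φ φ Φ Ψ
  simp only [negRules, Set.mem_insert_iff, Set.mem_singleton_iff, or_imp, forall_and, Rule.mk.injEq,
    and_imp, forall_eq_apply_imp_iff, forall_eq] at H
  simp [Fm.subst, Fm.subst_neg] at H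
  simp only [valueIn]
  split_ifs <;> simp_all [negTable]

theorem valueIn_or (hn : OLConn.neg ∈ S.ol)
    (ho : OLConn.or ∈ S.ol) (h : Closed (orRules hn ho) T) (φ ψ : Fm S) :
    valueIn hn T (Fm.or ho φ ψ) = orTable (valueIn hn T φ) (valueIn hn T ψ) := by
  have H := fun Φ Ψ => h.apply_two φ ψ Φ Ψ
  simp only [orRules, Set.mem_insert_iff, Set.mem_singleton_iff, or_imp, forall_and, Rule.mk.injEq,
    and_imp, forall_eq_apply_imp_iff, forall_eq] at H
  simp [Fm.subst, Fm.subst_neg, Fm.subst_or] at H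
  simp only [valueIn]
  split_ifs <;> simp_all [orTable]

theorem valueIn_and (hn : OLConn.neg ∈ S.ol)
    (ha : OLConn.and ∈ S.ol) (h : Closed (andRules hn ha) T) (φ ψ : Fm S) :
    valueIn hn T (Fm.and ha φ ψ) = andTable (valueIn hn T φ) (valueIn hn T ψ) := by
  have H := fun Φ Ψ => h.apply_two φ ψ Φ Ψ
  simp only [andRules, Set.mem_insert_iff, Set.mem_singleton_iff, or_imp, forall_and, Rule.mk.injEq,
    and_imp, forall_eq_apply_imp_iff, forall_eq] at H
  simp [Fm.subst, Fm.subst_neg, Fm.subst_and] at H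
  simp only [valueIn]
  split_ifs <;> simp_all [andTable]

theorem valueIn_imp (hn : OLConn.neg ∈ S.ol)
    (hi : OLConn.imp ∈ S.ol) (h : Closed (impRules hn hi) T) (φ ψ : Fm S) :
    valueIn hn T (Fm.imp hi φ ψ) = impTable (valueIn hn T φ) (valueIn hn T ψ) := by
  have H := fun Φ Ψ => h.apply_two φ ψ Φ Ψ
  simp only [impRules, Set.mem_insert_iff, Set.mem_singleton_iff, or_imp, forall_and, Rule.mk.injEq,
    and_imp, forall_eq_apply_imp_iff, forall_eq] at H
  simp [Fm.subst, Fm.subst_neg, Fm.subst_imp] at H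
  simp only [valueIn]
  split_ifs <;> simp_all [impTable]

theorem isValuation_valueIn (hM : M.IsOL) (hn : OLConn.neg ∈ S.ol) {R : S.Conn → Set (Rule S)}
    (hR : ∀ c, IsCalculusFor hn M c (R c)) (h : Closed (⋃ c, R c) T) :
    M.IsValuation (valueIn hn T) := by
  have hc : ∀ c, Closed (R c) T := fun c => h.mono (Set.subset_iUnion R c)
  have hneg : Closed (negRules hn) T := by
    rw [← show R (.ol .neg hn) = negRules hn from hR (.ol .neg hn)]
    exact hc _
  rintro (⟨_ | _ | _ | _, ho⟩ | e) a
  · rw [hM.1, show a = ![a 0] from List.ofFn_inj.1 rfl]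
    exact valueIn_neg hn hneg _
  · rw [hM.1, show a = ![a 0, a 1] from List.ofFn_inj.1 rfl]
    exact valueIn_or hn ho ((hR (.ol .or ho) : R _ = _) ▸ hc _) _ _
  · rw [hM.1, show a = ![a 0, a 1] from List.ofFn_inj.1 rfl]
    exact valueIn_and hn ho ((hR (.ol .and ho) : R _ = _) ▸ hc _) _ _
  · rw [hM.1, show a = ![a 0, a 1] from List.ofFn_inj.1 rfl]
    exact valueIn_imp hn ho ((hR (.ol .imp ho) : R _ = _) ▸ hc _) _ _
  · refine interp_of_closed_tableRules hn (valueIn_neg hn hneg) _ ?_ a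
    rw [theoryOf_valueIn]
    exact ((hR (.extra e)).closed_extra hn hneg).1 (hc _)

end Matrix

/-! ### The disjunction and the axiomatization -/

section Main

variable {S : Signature.{u}} {M : TMatrix S} {vee : Fm S → Fm S → Fm S}

/-- A derived connective that is designated exactly if one of its arguments is. -/
def IsSemanticDisjunction (M : TMatrix S) (op : Fm S → Fm S → Fm S) : Prop :=
  ∀ v, M.IsValuation v → ∀ a b, op a b ∈ theoryOf v ↔ a ∈ theoryOf v ∨ b ∈ theoryOf v

theorem structural_curlyVee {arrow : Fm S → Fm S → Fm S} (h : Structural arrow) :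
    Structural (curlyVee arrow) := by
  intro σ φ ψ
  simp only [curlyVee, h _]

/-- A check of nine pairs of values. The connective `∨` itself would not do, since `1/2 ∨ 0 = 0`. -/
theorem isSemanticDisjunction_curlyVee {arrow : Fm S → Fm S → Fm S}
    (h : ∀ v, M.IsValuation v → ∀ a b, v (arrow a b) = orTable (negTable (v a)) (v b)) :
    IsSemanticDisjunction M (curlyVee arrow) := by
  intro v hv a b
  simp only [theoryOf, Set.mem_ofPred_eq, curlyVee, h v hv]
  cases v a <;> cases v b <;> simp [orTable, negTable]

theorem structural_and_isSemanticDisjunction (hM : M.IsOL) (hn : OLConn.neg ∈ S.ol)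
    (hvee : (∃ h : OLConn.or ∈ S.ol, vee = curlyVee (arrowOr hn h)) ∨
      (∃ h : OLConn.and ∈ S.ol, vee = curlyVee (arrowAnd hn h))) :
    Structural vee ∧ IsSemanticDisjunction M vee := by
  rcases hvee with ⟨h, rfl⟩ | ⟨h, rfl⟩
  · refine ⟨structural_curlyVee fun σ φ ψ => ?_, isSemanticDisjunction_curlyVee fun v hv a b => ?_⟩
    · simp only [arrowOr, Fm.subst_or, Fm.subst_neg]
    · simp only [arrowOr, hv.or hM, hv.neg hM]
  · refine ⟨structural_curlyVee fun σ φ ψ => ?_, isSemanticDisjunction_curlyVee fun v hv a b => ?_⟩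
    · simp only [arrowAnd, Fm.subst_and, Fm.subst_neg]
    · simp only [arrowAnd, hv.and hM, hv.neg hM]
      cases v a <;> cases v b <;> rfl

theorem IsSemanticDisjunction.isDisjunction (h : IsSemanticDisjunction M vee) (hM : M.IsOL) :
    IsDisjunction M.Entails vee := by
  intro Γ φ ψ γ
  simp only [hM.entails_iff, Set.insert_subset_iff]
  constructor
  · intro H
    exact ⟨fun v hv hΓ => H v hv ⟨(h v hv _ _).2 (.inl hΓ.1), hΓ.2⟩,
      fun v hv hΓ => H v hv ⟨(h v hv _ _).2 (.inr hΓ.1), hΓ.2⟩⟩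
  · rintro ⟨H1, H2⟩ v hv ⟨ha, hΓ⟩
    exact ((h v hv _ _).1 ha).elim (fun ha => H1 v hv ⟨ha, hΓ⟩) fun ha => H2 v hv ⟨ha, hΓ⟩

theorem axiomatizesSC_translate (hM : M.IsOL) (hn : OLConn.neg ∈ S.ol) (hop : Structural vee)
    (hd : IsSemanticDisjunction M vee) {R : S.Conn → Set (Rule S)}
    (hR : ∀ c, IsCalculusFor hn M c (R c)) {p₀ : Rule S → ℕ}
    (hp₀ : ∀ r ∈ ⋃ c, R c, ¬ r.Occurs (p₀ r)) :
    AxiomatizesSC (translate vee p₀ (⋃ c, R c)) M.Entails := by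
  refine ⟨isSingleConclusion_translate p₀ _, fun Γ φ => ?_⟩
  rw [hM.entails_iff]
  constructor
  · intro h
    by_contra hc
    obtain ⟨T, hΓ, hφ, hT⟩ := exists_closed_of_not_proves_translate hop hp₀ hc
    -- The valuation read off from `T` designates exactly the members of `T`, hence all of `Γ` but
    -- not `φ`.
    have := h _ (isValuation_valueIn hM hn hR hT)
    rw [theoryOf_valueIn] at this
    exact hφ (this hΓ)
  · intro h v hv hΓ
    have hT : Closed (⋃ c, R c) (theoryOf v) := by
      intro r hr
      obtain ⟨c, hr⟩ := Set.mem_iUnion.1 hr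
      exact hv.closed_of_isCalculusFor hM hn (hR c) r hr
    obtain ⟨_, rfl, hφ⟩ := (hT.translate hop (hd v hv) p₀).exists_mem h hΓ
    exact hφ

/-- The multiple-conclusion rules of the connectives `¬`, `∨`, `∧`, `→`. -/
def olRules (hn : OLConn.neg ∈ S.ol) : S.Conn → Set (Rule S)
  | .ol .neg _ => negRules hn
  | .ol .or h => orRules hn h
  | .ol .and h => andRules hn h
  | .ol .imp h => impRules hn h
  | .extra _ => ∅

theorem isCalculusFor_olRules [IsEmpty S.Extra] (hn : OLConn.neg ∈ S.ol) (c : S.Conn) :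
    IsCalculusFor hn M c (olRules hn c) := by
  rcases c with ⟨_ | _ | _ | _, h⟩ | e
  iterate 4 exact rfl
  exact isEmptyElim e

theorem not_occurs_olRules (hn : OLConn.neg ∈ S.ol) (c : S.Conn) :
    ∀ r ∈ olRules hn c, ¬ r.Occurs 2 := by
  rcases c with ⟨_ | _ | _ | _, h⟩ | e <;>
    simp [olRules, negRules, orRules, andRules, impRules, Rule.Occurs, Fm.Occurs, Fm.neg, Fm.or,
      Fm.and, Fm.imp, Fin.exists_fin_succ]

/-- The displayed side variable is variable 2, while the multiple-conclusion rules use only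
variables 0 and 1; each displayed set is the image of the original one under translation. -/
theorem scCalculus_eq_translate (hn : OLConn.neg ∈ S.ol) (op : Fm S → Fm S → Fm S) :
    scCalculus hn op = translate op (fun _ => 2) (⋃ c, olRules hn c) := by
  have h1 : Rule.trans op 2 '' negRules hn = scNegRules hn op := by
    simp only [negRules, Set.image_insert_eq, Set.image_singleton]; rfl
  have h2 : ∀ h, Rule.trans op 2 '' orRules hn h = scOrRules hn h op := fun h => by
    simp only [orRules, Set.image_insert_eq, Set.image_singleton]; rfl
  have h3 : ∀ h, Rule.trans op 2 '' andRules hn h = scAndRules hn h op := fun h => by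
    simp only [andRules, Set.image_insert_eq, Set.image_singleton]; rfl
  have h4 : ∀ h, Rule.trans op 2 '' impRules hn h = scImpRules hn h op := fun h => by
    simp only [impRules, Set.image_insert_eq, Set.image_singleton]; rfl
  have himg : {s | ∃ r ∈ ⋃ c, olRules hn c, s = Rule.trans op 2 r} =
      ⋃ c, Rule.trans op 2 '' olRules hn c := by
    rw [← Set.image_iUnion]
    ext s
    simp only [Set.mem_image, Set.mem_ofPred_eq, eq_comm]
  rw [translate, himg]
  ext s
  simp only [scCalculus, ← h1, ← h2, ← h3, ← h4, Set.mem_union, Set.mem_iUnion, Set.mem_ofPred_eq]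
  constructor
  · rintro ((((h | h) | ⟨hc, h⟩) | ⟨hc, h⟩) | ⟨hc, h⟩)
    · exact .inl h
    · exact .inr ⟨.ol .neg hn, h⟩
    · exact .inr ⟨.ol .imp hc, h⟩
    · exact .inr ⟨.ol .or hc, h⟩
    · exact .inr ⟨.ol .and hc, h⟩
  · rintro (h | ⟨⟨_ | _ | _ | _, hc⟩ | e, h⟩)
    · exact .inl (.inl (.inl (.inl h)))
    · exact .inl (.inl (.inl (.inr h)))
    · exact .inl (.inr ⟨hc, h⟩)
    · exact .inr ⟨hc, h⟩
    · exact .inl (.inl (.inr ⟨hc, h⟩))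
    · simp [olRules] at h

end Main

end Cooper

theorem mainTheorem5 (S : Cooper.Signature.{u}) (M : Cooper.TMatrix S) (hM : M.IsOL)
    (hn : Cooper.OLConn.neg ∈ S.ol)
    (vee : Cooper.Fm S → Cooper.Fm S → Cooper.Fm S)
    (hvee : (∃ h : Cooper.OLConn.or ∈ S.ol, vee = Cooper.curlyVee (Cooper.arrowOr hn h)) ∨
      (∃ h : Cooper.OLConn.and ∈ S.ol, vee = Cooper.curlyVee (Cooper.arrowAnd hn h))) :
    Cooper.IsDisjunction M.Entails vee ∧
    (∀ R : S.Conn → Set (Cooper.Rule S),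
      (∀ c, Cooper.IsCalculusFor hn M c (R c)) →
      ∀ p₀ : Cooper.Rule S → ℕ, (∀ r ∈ ⋃ c, R c, ¬ r.Occurs (p₀ r)) →
        Cooper.AxiomatizesSC (Cooper.translate vee p₀ (⋃ c, R c)) M.Entails) ∧
    (IsEmpty S.Extra → Cooper.AxiomatizesSC (Cooper.scCalculus hn vee) M.Entails) := by 
  obtain ⟨hop, hd⟩ := Cooper.structural_and_isSemanticDisjunction hM hn hvee
  refine ⟨hd.isDisjunction hM, fun R hR p₀ hp₀ => ?_, fun _ => ?_⟩
  · exact Cooper.axiomatizesSC_translate hM hn hop hd hR hp₀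
  · rw [Cooper.scCalculus_eq_translate]
    refine Cooper.axiomatizesSC_translate hM hn hop hd (Cooper.isCalculusFor_olRules hn) ?_
    intro r hr
    obtain ⟨c, hr⟩ := Set.mem_iUnion.1 hr
    exact Cooper.not_occurs_olRules hn c r hr
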